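/- Setting. Let $z=(t,x^1,x^2,x^3)\in\mathbb R\times\mathbb R^3$ and let $J$ be the jet space with coordinates $(z,(u^\alpha_I)_{\alpha,I})$, where $\alpha=1,\dots,m$ and $I$ runs over the multi-indices in $t,x^1,x^2,x^3$. Fix an open domain $\mathcal D\subseteq J$. A *differential function* is a function on $\mathcal D$ that is a smooth function of $z$ and finitely many of the $u^\alpha_I$; a *vector differential function* has three such components. The total derivatives are $D_i=\partial_{z^i}+\sum_{\alpha,I}u^\alpha_{I+e_i}\,\partial_{u^\alpha_I}$ (with $D_t$ the one for $t$ and $D_1,D_2,D_3$ the spatial ones), and $\operatorname{Grad},\operatorname{Div},\operatorname{Curl}$ are the usual operators built from $D_1,D_2,D_3$. Let $G^a[u]=0$ $(a=1,\dots,M)$ be a system of partial differential equations whose left-hand sides are differential functions. A solution on an open set $U\subseteq\mathbb R\times\mathbb R^3$ is a smooth function $u=(u^1,\dots,u^m)$ on $U$ whose jets lie in $\mathcal D$ and which satisfies all the equations on $U$. Fix any collection of open sets $U$ on which solutions are considered (e.g. only the whole space, or all open sets). For functions $f,g$ on jet space, $f|_{\mathcal E}=g|_{\mathcal E}$ means that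 $f$ and $g$ agree at the jet at $z$ of every such solution, for every $z\in U$. A *time-dependent (local) surface-flux conservation law* is a pair $(\vec T,\vec X)$ of vector differential functions with $$(D_t\vec T+\operatorname{Curl}\vec X)|_{\mathcal E}=0 .$$ It is *locally trivial* if there are a vector differential function $\vec\Theta$ and a scalar differential function $\Lambda$ with $$\vec T|_{\mathcal E}=\operatorname{Curl}\vec\Theta|_{\mathcal E},\qquad \vec X|_{\mathcal E}=(-D_t\vec\Theta+\operatorname{Grad}\Lambda)|_{\mathcal E}.$$ A *topological flux conservation law* (in local form, a spatial divergence conservation law) is a vector differential function $\vec\Psi$ with $\operatorname{Div}\vec\Psi|_{\mathcal E}=0$; it is *trivial* if $\vec\Psi|_{\mathcal E}=\operatorname{Curl}\vec\Theta|_{\mathcal E}$ for some vector differential function $\vec\Theta$. A *topological circulation conservation law* (in local form, a spatial curl conservation law) is a vector differential function $\vec\Psi$ with $\operatorname{Curl}\vec\Psi|_{\mathcal E}=0$; it is *trivial* if $\vec\Psi|_{\mathcal E}=\operatorname{Grad}\Theta|_{\mathcal E}$ for some scalar differential function $\Theta$. Proposition. Let $(\vec T,\vec X)$ be a time-dependent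 surface-flux conservation law of the system. (i) If $(\vec T,\vec X)$ is locally trivial, then $\operatorname{Div}\vec T|_{\mathcal E}=0$. (ii) Suppose that every topological flux conservation law of the system is trivial and every topological circulation conservation law of the system is trivial. If $\operatorname{Div}\vec T|_{\mathcal E}=0$, then $(\vec T,\vec X)$ is locally trivial. -/

import Mathlib

open scoped ContDiff

noncomputable section

namespace SurfaceFlux

/-! ### Jet space -/

/-- Points `z = (t, x¹, x², x³)` of `ℝ × ℝ³`: index `0` is time, indices `1, 2, 3` are the
Cartesian space coordinates. -/
abbrev Spacetime : Type := Fin 4 → ℝ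

/-- `I = (I₀, I₁, I₂, I₃)` stands for the derivative `∂_t^I₀ ∂_1^I₁ ∂_2^I₂ ∂_3^I₃`. -/
abbrev MultiIndex : Type := Fin 4 → ℕ

/-- The jet variables `u^α_I` (with `u^α_0 = u^α`) of `m` dependent variables. -/
abbrev JetVar (m : ℕ) : Type := Fin m × MultiIndex

/-- The (infinite) jet space, with coordinates `(z, (u^α_I)_{α, I})` and the product topology. -/
abbrev Jet (m : ℕ) : Type := Spacetime × (JetVar m → ℝ)

/-- Forget all jet variables except the finitely many in `S`. -/
def jetProj {m : ℕ} (S : Finset (JetVar m)) (p : Jet m) : Spacetime × (S → ℝ) :=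
  (p.1, fun c => p.2 c)

/-- `f` is a (scalar) differential function on the domain `𝒟` of jet space: on `𝒟` it is a smooth
function of `z` and of finitely many jet variables. -/
def IsDiffFun {m : ℕ} (𝒟 : Set (Jet m)) (f : Jet m → ℝ) : Prop :=
  ∃ (S : Finset (JetVar m)) (F : Spacetime × (S → ℝ) → ℝ),
    ContDiffOn ℝ ∞ F (jetProj S '' 𝒟) ∧ ∀ p ∈ 𝒟, f p = F (jetProj S p)

/-- Vector differential functions: all three Cartesian components are differential functions. -/
def IsVecDiffFun {m : ℕ} (𝒟 : Set (Jet m)) (f : Fin 3 → Jet m → ℝ) : Prop :=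
  ∀ j, IsDiffFun 𝒟 (f j)

/-- The total derivative `D_i = ∂/∂z^i + ∑_{α, I} u^α_{I + e_i} ∂/∂u^α_I`. For a differential
function only finitely many terms of the sum are non-zero. -/
def totalD {m : ℕ} (i : Fin 4) (f : Jet m → ℝ) (p : Jet m) : ℝ :=
  deriv (fun s => f (Function.update p.1 i s, p.2)) (p.1 i) +
    ∑ᶠ c : JetVar m, p.2 (c.1, c.2 + Pi.single i 1) *
      deriv (fun s => f (p.1, Function.update p.2 c s)) (p.2 c)

/-- `D_t`, applied to vector differential functions componentwise. -/
def vecDt {m : ℕ} (f : Fin 3 → Jet m → ℝ) : Fin 3 → Jet m → ℝ :=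
  fun j => totalD 0 (f j)

/-- The total gradient `(D_1 f, D_2 f, D_3 f)`. -/
def Grad {m : ℕ} (f : Jet m → ℝ) : Fin 3 → Jet m → ℝ :=
  fun j => totalD j.succ f

/-- The total divergence `D_1 f¹ + D_2 f² + D_3 f³`. -/
def Div {m : ℕ} (f : Fin 3 → Jet m → ℝ) : Jet m → ℝ :=
  totalD 1 (f 0) + totalD 2 (f 1) + totalD 3 (f 2)

/-- The total curl `(D_2 f³ - D_3 f², D_3 f¹ - D_1 f³, D_1 f² - D_2 f¹)`. -/
def Curl {m : ℕ} (f : Fin 3 → Jet m → ℝ) : Fin 3 → Jet m → ℝ :=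
  ![totalD 2 (f 2) - totalD 3 (f 1),
    totalD 3 (f 0) - totalD 1 (f 2),
    totalD 1 (f 1) - totalD 2 (f 0)]

/-! ### Jets of functions -/

/-- The partial derivative `∂g/∂z^i`. -/
def partialD (i : Fin 4) (g : Spacetime → ℝ) (z : Spacetime) : ℝ :=
  fderiv ℝ g z (Pi.single i 1)

/-- `∂_t^I₀ ∂_1^I₁ ∂_2^I₂ ∂_3^I₃ g`. -/
def multiD (I : MultiIndex) (g : Spacetime → ℝ) : Spacetime → ℝ :=
  (partialD 0)^[I 0] ((partialD 1)^[I 1] ((partialD 2)^[I 2] ((partialD 3)^[I 3] g)))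

/-- The point of jet space given by `z` and the values at `z` of all derivatives of `u`. -/
def jetOf {m : ℕ} (u : Fin m → Spacetime → ℝ) (z : Spacetime) : Jet m :=
  (z, fun c => multiD c.2 (u c.1) z)

/-! ### PDE systems and their solution spaces -/

/-- A system of `M` partial differential equations `G^a[u] = 0` for `m` dependent variables
`u^α(t, x)` in three space dimensions. `dom` is the domain of jet space on which differential
functions are considered (the whole jet space, or for instance `ρ > 0` for gas dynamics). -/
structure PDESystem (m M : ℕ) where
  dom : Set (Jet m)
  isOpen_dom : IsOpen dom
  eqn : Fin M → Jet m → ℝ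
  eqn_isDiffFun : ∀ a, IsDiffFun dom (eqn a)

variable {m M : ℕ}

/-- `u` is a (smooth) solution of the system on the open set `U` of `ℝ × ℝ³`. -/
def PDESystem.IsSolutionOn (P : PDESystem m M) (U : Set Spacetime)
    (u : Fin m → Spacetime → ℝ) : Prop :=
  (∀ α, ContDiffOn ℝ ∞ (u α) U) ∧
    ∀ z ∈ U, jetOf u z ∈ P.dom ∧ ∀ a, P.eqn a (jetOf u z) = 0

/-- The solution space as a subset of jet space: all jets of solutions, where solutions are
considered on the members `U` of the collection `𝒪` of open sets of `ℝ × ℝ³` (for instance only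
the whole space, all `(a, b) × ℝ³`, or all open sets). -/
def PDESystem.solSpace (P : PDESystem m M) (𝒪 : Set (Set Spacetime)) : Set (Jet m) :=
  {p | ∃ U ∈ 𝒪, ∃ u : Fin m → Spacetime → ℝ, P.IsSolutionOn U u ∧ ∃ z ∈ U, jetOf u z = p}

/-- `f|_ℰ = g|_ℰ` for scalar functions on jet space. -/
def EqOnSol (P : PDESystem m M) (𝒪 : Set (Set Spacetime)) (f g : Jet m → ℝ) : Prop :=
  ∀ p ∈ P.solSpace 𝒪, f p = g p

/-- `f|_ℰ = g|_ℰ` for vector functions on jet space. -/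
def VecEqOnSol (P : PDESystem m M) (𝒪 : Set (Set Spacetime)) (f g : Fin 3 → Jet m → ℝ) : Prop :=
  ∀ j, EqOnSol P 𝒪 (f j) (g j)

/-! ### Conservation laws and their triviality -/

/-- A time-dependent (local) surface-flux conservation law `(D_t T + Curl X)|_ℰ = 0`, with
conserved flux density `T` and spatial circulation flux `X`. -/
structure IsSurfaceFluxLaw (P : PDESystem m M) (𝒪 : Set (Set Spacetime))
    (T X : Fin 3 → Jet m → ℝ) : Prop where
  density : IsVecDiffFun P.dom T
  flux : IsVecDiffFun P.dom X
  conserved : VecEqOnSol P 𝒪 (vecDt T + Curl X) 0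

/-- Local triviality of a surface-flux conservation law:
`T|_ℰ = Curl Θ|_ℰ` and `X|_ℰ = (- D_t Θ + Grad Λ)|_ℰ`. -/
def IsLocallyTrivialSurfaceFlux (P : PDESystem m M) (𝒪 : Set (Set Spacetime))
    (T X : Fin 3 → Jet m → ℝ) : Prop :=
  ∃ (Θ : Fin 3 → Jet m → ℝ) (Λ : Jet m → ℝ), IsVecDiffFun P.dom Θ ∧ IsDiffFun P.dom Λ ∧
    VecEqOnSol P 𝒪 T (Curl Θ) ∧ VecEqOnSol P 𝒪 X (-vecDt Θ + Grad Λ)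

/-- A topological flux (spatial divergence) conservation law `(Div Ψ)|_ℰ = 0`. -/
structure IsTopologicalFluxLaw (P : PDESystem m M) (𝒪 : Set (Set Spacetime))
    (Ψ : Fin 3 → Jet m → ℝ) : Prop where
  flux : IsVecDiffFun P.dom Ψ
  conserved : EqOnSol P 𝒪 (Div Ψ) 0

/-- Triviality of a topological flux conservation law: `Ψ|_ℰ = Curl Θ|_ℰ`. -/
def IsTrivialTopologicalFlux (P : PDESystem m M) (𝒪 : Set (Set Spacetime))
    (Ψ : Fin 3 → Jet m → ℝ) : Prop :=
  ∃ Θ : Fin 3 → Jet m → ℝ, IsVecDiffFun P.dom Θ ∧ VecEqOnSol P 𝒪 Ψ (Curl Θ)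

/-- A topological circulation (spatial curl) conservation law `(Curl Ψ)|_ℰ = 0`. -/
structure IsTopologicalCirculationLaw (P : PDESystem m M) (𝒪 : Set (Set Spacetime))
    (Ψ : Fin 3 → Jet m → ℝ) : Prop where
  circulation : IsVecDiffFun P.dom Ψ
  conserved : VecEqOnSol P 𝒪 (Curl Ψ) 0

/-- Triviality of a topological circulation conservation law: `Ψ|_ℰ = Grad Θ|_ℰ`. -/
def IsTrivialTopologicalCirculation (P : PDESystem m M) (𝒪 : Set (Set Spacetime))
    (Ψ : Fin 3 → Jet m → ℝ) : Prop :=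
  ∃ Θ : Jet m → ℝ, IsDiffFun P.dom Θ ∧ VecEqOnSol P 𝒪 Ψ (Grad Θ)

end SurfaceFlux

end

noncomputable section

namespace SurfaceFlux

/-! ### Partial derivatives on open sets -/

variable {U : Set Spacetime} {g h : Spacetime → ℝ}

/-! Every point of the solution space is the jet of a solution `u` on an open set `U`, and along `u`
total derivatives become partial derivatives of `f ∘ jetOf u` (`IsDiffFun.partialD_comp_jetOf`).
Hence total derivatives respect equality on the solution space (`EqOnSol.totalD`) and commute there
(`eqOnSol_totalD_comm`), with no regularity of that space required. Vector calculus does the rest.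
If `T = Curl Θ`, then `Div T = Div (Curl Θ) = 0`. Conversely, `Div T = 0` makes `T` a topological
flux law, so `T = Curl Θ`; then `D_t T + Curl X = 0` reads `Curl (X + D_t Θ) = 0`, and triviality of
circulation laws gives `X + D_t Θ = Grad Λ`. -/

theorem contDiffOn_partialD (hU : IsOpen U) (hg : ContDiffOn ℝ ∞ g U) (i : Fin 4) :
    ContDiffOn ℝ ∞ (partialD i g) U :=
  (hg.fderiv_of_isOpen hU (m := ∞) (by simp)).clm_apply contDiffOn_const

theorem differentiableAt_of_contDiffOn (hU : IsOpen U) (hg : ContDiffOn ℝ ∞ g U) {z : Spacetime}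
    (hz : z ∈ U) : DifferentiableAt ℝ g z :=
  (hg.contDiffAt (hU.mem_nhds hz)).differentiableAt (by simp)

theorem eqOn_partialD (hU : IsOpen U) (hgh : Set.EqOn g h U) (i : Fin 4) :
    Set.EqOn (partialD i g) (partialD i h) U := by
  intro z hz
  have : g =ᶠ[nhds z] h := Filter.eventuallyEq_of_mem (hU.mem_nhds hz) hgh
  simp only [partialD, this.fderiv_eq]

theorem partialD_comm (hU : IsOpen U) (hg : ContDiffOn ℝ ∞ g U) (i j : Fin 4) :
    Set.EqOn (partialD i (partialD j g)) (partialD j (partialD i g)) U := by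
  intro z hz
  have hd : DifferentiableAt ℝ (fderiv ℝ g) z :=
    ((hg.fderiv_of_isOpen hU (m := ∞) (by simp)).contDiffAt (hU.mem_nhds hz)).differentiableAt
      (by simp)
  have key : ∀ a b : Fin 4, partialD a (partialD b g) z =
      fderiv ℝ (fderiv ℝ g) z (Pi.single a 1) (Pi.single b 1) := by
    intro a b
    change fderiv ℝ (fun y => fderiv ℝ g y (Pi.single b 1)) z (Pi.single a 1) = _
    rw [fderiv_clm_apply hd (differentiableAt_const _)]
    simp
  rw [key, key]
  exact ((hg.contDiffAt (hU.mem_nhds hz)).isSymmSndFDerivAt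
    (by simpa using (WithTop.coe_le_coe.2 le_top : ((2 : ℕ∞) : WithTop ℕ∞) ≤ ∞))).eq _ _

theorem partialD_add (hU : IsOpen U) (hg : ContDiffOn ℝ ∞ g U) (hh : ContDiffOn ℝ ∞ h U)
    (i : Fin 4) {z : Spacetime} (hz : z ∈ U) :
    partialD i (g + h) z = partialD i g z + partialD i h z := by
  simp only [partialD]
  rw [fderiv_add (differentiableAt_of_contDiffOn hU hg hz)
    (differentiableAt_of_contDiffOn hU hh hz)]
  rfl

theorem contDiffOn_iterate_partialD (hU : IsOpen U) (hg : ContDiffOn ℝ ∞ g U) (i : Fin 4) (n : ℕ) :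
    ContDiffOn ℝ ∞ ((partialD i)^[n] g) U := by
  induction n with
  | zero => exact hg
  | succ n ih =>
    rw [Function.iterate_succ_apply']
    exact contDiffOn_partialD hU ih i

theorem eqOn_iterate_partialD (hU : IsOpen U) (hgh : Set.EqOn g h U) (i : Fin 4) (n : ℕ) :
    Set.EqOn ((partialD i)^[n] g) ((partialD i)^[n] h) U := by
  induction n with
  | zero => exact hgh
  | succ n ih =>
    rw [Function.iterate_succ_apply', Function.iterate_succ_apply']
    exact eqOn_partialD hU ih i

theorem partialD_iterate_comm (hU : IsOpen U) (hg : ContDiffOn ℝ ∞ g U) (i j : Fin 4) (n : ℕ) :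
    Set.EqOn (partialD i ((partialD j)^[n] g)) ((partialD j)^[n] (partialD i g)) U := by
  induction n with
  | zero => exact fun _ _ => rfl
  | succ n ih =>
    rw [Function.iterate_succ_apply', Function.iterate_succ_apply']
    exact (partialD_comm hU (contDiffOn_iterate_partialD hU hg j n) i j).trans
      (eqOn_partialD hU ih j)

theorem contDiffOn_multiD (hU : IsOpen U) (hg : ContDiffOn ℝ ∞ g U) (I : MultiIndex) :
    ContDiffOn ℝ ∞ (multiD I g) U :=
  contDiffOn_iterate_partialD hU (contDiffOn_iterate_partialD hU (contDiffOn_iterate_partialD hU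
    (contDiffOn_iterate_partialD hU hg 3 _) 2 _) 1 _) 0 _

/-- `multiD` applies its derivatives in a fixed order, so `∂_i` has to be moved inward past the
blocks of index less than `i`. The equalities hold only on `U`; openness lets them be differentiated
again. -/
theorem partialD_multiD (hU : IsOpen U) (hg : ContDiffOn ℝ ∞ g U) (i : Fin 4) (I : MultiIndex) :
    Set.EqOn (partialD i (multiD I g)) (multiD (I + Pi.single i 1) g) U := by
  have h3 := contDiffOn_iterate_partialD hU hg 3 (I 3)
  have h2 := contDiffOn_iterate_partialD hU h3 2 (I 2)
  have h1 := contDiffOn_iterate_partialD hU h2 1 (I 1)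
  unfold multiD
  fin_cases i
  · simp [Function.iterate_succ_apply', Set.eqOn_refl]
  · refine (partialD_iterate_comm hU h1 _ _ _).trans ?_
    simp [Function.iterate_succ_apply', Set.eqOn_refl]
  · refine (partialD_iterate_comm hU h1 _ _ _).trans ?_
    refine (eqOn_iterate_partialD hU (partialD_iterate_comm hU h2 _ _ _) _ _).trans ?_
    simp [Function.iterate_succ_apply', Set.eqOn_refl]
  · refine (partialD_iterate_comm hU h1 _ _ _).trans ?_
    refine (eqOn_iterate_partialD hU (partialD_iterate_comm hU h2 _ _ _) _ _).trans ?_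
    refine (eqOn_iterate_partialD hU (eqOn_iterate_partialD hU
      (partialD_iterate_comm hU h3 _ _ _) _ _) _ _).trans ?_
    simp [Function.iterate_succ_apply', Set.eqOn_refl]

/-! ### Total derivatives of differential functions -/

variable {m M : ℕ} {𝒟 : Set (Jet m)} {f f' : Jet m → ℝ}

/-- A continuous section through a given `v` fills the forgotten coordinates with those of `v`.
Openness of the image makes `fderiv` of a representative meaningful at each of its points. -/
theorem isOpenMap_jetProj (S : Finset (JetVar m)) : IsOpenMap (jetProj S) := by
  have : IsOpenMap (fun (v : JetVar m → ℝ) (c : S) => v c) := by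
    classical
    refine IsOpenMap.of_sections fun v => ?_
    refine ⟨fun w c => if hc : c ∈ S then w ⟨c, hc⟩ else v c, ?_, ?_, ?_⟩
    · refine Continuous.continuousAt (continuous_pi fun c => ?_)
      by_cases hc : c ∈ S
      · simpa [hc] using continuous_apply _
      · simpa [hc] using continuous_const
    · funext c
      by_cases hc : c ∈ S <;> simp [hc]
    · intro w
      funext c
      simp
  exact IsOpenMap.id.prodMap this

/-- A differential function is, on an open domain, the pullback along a coordinate projection of a
function that is smooth on the open image of the domain. -/
theorem IsDiffFun.exists_rep (h𝒟 : IsOpen 𝒟) (hf : IsDiffFun 𝒟 f) :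
    ∃ (S : Finset (JetVar m)) (F : Spacetime × (S → ℝ) → ℝ), IsOpen (jetProj S '' 𝒟) ∧
      ContDiffOn ℝ ∞ F (jetProj S '' 𝒟) ∧ ∀ p ∈ 𝒟, f p = F (jetProj S p) := by
  obtain ⟨S, F, hF, hfF⟩ := hf
  exact ⟨S, F, isOpenMap_jetProj S _ h𝒟, hF, hfF⟩

/-- Each coordinate derivative of `f` is a directional derivative of `F`. By linearity their
weighted sum is a single derivative, in the direction of the total derivative. -/
theorem totalD_eq_fderiv (h𝒟 : IsOpen 𝒟) {S : Finset (JetVar m)} {F : Spacetime × (S → ℝ) → ℝ}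
    (hF : ContDiffOn ℝ ∞ F (jetProj S '' 𝒟)) (hfF : ∀ p ∈ 𝒟, f p = F (jetProj S p))
    (i : Fin 4) {p : Jet m} (hp : p ∈ 𝒟) :
    totalD i f p = fderiv ℝ F (jetProj S p)
      (Pi.single i 1, fun c : S => p.2 (c.1.1, c.1.2 + Pi.single i 1)) := by
  classical
  have hd : HasFDerivAt F (fderiv ℝ F (jetProj S p)) (jetProj S p) :=
    ((hF.contDiffAt ((isOpenMap_jetProj S _ h𝒟).mem_nhds ⟨p, hp, rfl⟩)).differentiableAt
      (by simp)).hasFDerivAt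
  -- `f` is controlled only on `𝒟`; a continuous curve through `p` stays there for nearby
  -- parameters.
  have curve : ∀ (γ : ℝ → Jet m) (s : ℝ) (w : Spacetime × (S → ℝ)), Continuous γ → γ s = p →
      HasDerivAt (fun r => jetProj S (γ r)) w s →
      deriv (fun r => f (γ r)) s = fderiv ℝ F (jetProj S p) w := by
    intro γ s w hγ hs hw
    have hev : (fun r => f (γ r)) =ᶠ[nhds s] fun r => F (jetProj S (γ r)) := by
      filter_upwards [hγ.continuousAt.preimage_mem_nhds (h𝒟.mem_nhds (hs ▸ hp))] with r hr
      exact hfF _ hr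
    rw [hev.deriv_eq]
    have hd' : HasFDerivAt F (fderiv ℝ F (jetProj S p)) (jetProj S (γ s)) := by rwa [hs]
    exact (hd'.comp_hasDerivAt s hw).deriv
  have htime : deriv (fun s => f (Function.update p.1 i s, p.2)) (p.1 i) =
      fderiv ℝ F (jetProj S p) (Pi.single i 1, 0) := by
    refine curve (fun s => (Function.update p.1 i s, p.2)) _ _ (by fun_prop) (by simp) ?_
    exact (hasDerivAt_update p.1 i _).prodMk
      (hasDerivAt_const (p.1 i) fun c : S => p.2 c)
  have hjet : ∀ c, deriv (fun s => f (p.1, Function.update p.2 c s)) (p.2 c) =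
      fderiv ℝ F (jetProj S p) (0, fun b : S => (Pi.single c 1 : JetVar m → ℝ) b) := by
    intro c
    refine curve (fun s => (p.1, Function.update p.2 c s)) _ _ (by fun_prop) (by simp) ?_
    refine (hasDerivAt_const _ _).prodMk (hasDerivAt_pi.2 fun b => ?_)
    by_cases hb : (b : JetVar m) = c
    · subst hb
      simpa using hasDerivAt_id' (p.2 b)
    · simpa [hb] using hasDerivAt_const _ _
  unfold totalD
  simp only [htime, hjet]
  rw [finsum_eq_sum_of_support_subset (s := S), ← Finset.sum_coe_sort S]
  · have : ((Pi.single i 1, fun c : S => p.2 (c.1.1, c.1.2 + Pi.single i 1)) :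
        Spacetime × (S → ℝ)) = (Pi.single i 1, 0) + ∑ c : S,
          p.2 (c.1.1, c.1.2 + Pi.single i 1) •
            ((0, fun b : S => (Pi.single c.1 1 : JetVar m → ℝ) b) : Spacetime × (S → ℝ)) := by
      refine Prod.ext ?_ ?_
      · simp [Prod.fst_sum]
      · funext b
        simp [Prod.snd_sum, Finset.sum_apply, Pi.single_apply]
    rw [this, map_add, map_sum]
    simp only [map_smul, smul_eq_mul]
  -- A variable outside `S` moves the projected point in the zero direction.
  · intro c hc
    by_contra hcS
    refine hc ?_
    have : (fun b : S => (Pi.single c 1 : JetVar m → ℝ) b) = 0 := by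
      funext b
      have : (b : JetVar m) ≠ c := fun hb => hcS (hb ▸ b.2)
      simp [this]
    simp only [this]
    rw [show ((0, 0) : Spacetime × (S → ℝ)) = 0 from rfl, map_zero, mul_zero]

theorem IsDiffFun.totalD (h𝒟 : IsOpen 𝒟) (hf : IsDiffFun 𝒟 f) (i : Fin 4) :
    IsDiffFun 𝒟 (totalD i f) := by
  classical
  obtain ⟨S, F, hSo, hF, hfF⟩ := hf.exists_rep h𝒟
  -- The coefficients `u^α_{I + e_i}` may be new variables, so `S` is enlarged by its shift.
  let shift : JetVar m → JetVar m := fun c => (c.1, c.2 + Pi.single i 1)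
  let S' : Finset (JetVar m) := S ∪ S.image shift
  have hS : ∀ c : S, c.1 ∈ S' := fun c => Finset.mem_union_left _ c.2
  have hS' : ∀ c : S, shift c.1 ∈ S' :=
    fun c => Finset.mem_union_right _ (Finset.mem_image_of_mem _ c.2)
  refine ⟨S', fun q => fderiv ℝ F (q.1, fun c : S => q.2 ⟨c.1, hS c⟩)
    (Pi.single i 1, fun c : S => q.2 ⟨shift c.1, hS' c⟩), ?_, ?_⟩
  · refine ContDiffOn.clm_apply ?_ (ContDiff.contDiffOn (by fun_prop))
    refine (hF.fderiv_of_isOpen hSo (m := ∞) (by simp)).comp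
      (ContDiff.contDiffOn (by fun_prop)) ?_
    rintro _ ⟨p, hp, rfl⟩
    exact ⟨p, hp, rfl⟩
  · intro p hp
    exact totalD_eq_fderiv h𝒟 hF hfF i hp

theorem IsDiffFun.add (hf : IsDiffFun 𝒟 f) (hf' : IsDiffFun 𝒟 f') : IsDiffFun 𝒟 (f + f') := by
  classical
  obtain ⟨S, F, hF, hfF⟩ := hf
  obtain ⟨S', F', hF', hfF'⟩ := hf'
  have hS : ∀ c : S, c.1 ∈ S ∪ S' := fun c => Finset.mem_union_left _ c.2
  have hS' : ∀ c : S', c.1 ∈ S ∪ S' := fun c => Finset.mem_union_right _ c.2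
  refine ⟨S ∪ S', fun q => F (q.1, fun c : S => q.2 ⟨c.1, hS c⟩) +
    F' (q.1, fun c : S' => q.2 ⟨c.1, hS' c⟩), ?_, ?_⟩
  · refine ContDiffOn.add (hF.comp (ContDiff.contDiffOn (by fun_prop)) ?_)
      (hF'.comp (ContDiff.contDiffOn (by fun_prop)) ?_)
    · rintro _ ⟨p, hp, rfl⟩
      exact ⟨p, hp, rfl⟩
    · rintro _ ⟨p, hp, rfl⟩
      exact ⟨p, hp, rfl⟩
  · intro p hp
    rw [Pi.add_apply, hfF p hp, hfF' p hp]
    rfl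

/-! ### Differential functions along smooth functions -/

variable {u : Fin m → Spacetime → ℝ}

theorem contDiffOn_jetProj_jetOf (hU : IsOpen U) (hu : ∀ α, ContDiffOn ℝ ∞ (u α) U)
    (S : Finset (JetVar m)) : ContDiffOn ℝ ∞ (fun z => jetProj S (jetOf u z)) U :=
  contDiffOn_id.prodMk (contDiffOn_pi.2 fun _ => contDiffOn_multiD hU (hu _) _)

theorem IsDiffFun.contDiffOn_comp_jetOf (hf : IsDiffFun 𝒟 f) (hU : IsOpen U)
    (hu : ∀ α, ContDiffOn ℝ ∞ (u α) U) (hu𝒟 : ∀ z ∈ U, jetOf u z ∈ 𝒟) :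
    ContDiffOn ℝ ∞ (fun z => f (jetOf u z)) U := by
  obtain ⟨S, F, hF, hfF⟩ := hf
  exact (hF.comp (contDiffOn_jetProj_jetOf hU hu S) fun z hz => ⟨_, hu𝒟 z hz, rfl⟩).congr
    fun z hz => hfF _ (hu𝒟 z hz)

/-- Chain rule: along a smooth function, total derivatives are partial derivatives. -/
theorem IsDiffFun.partialD_comp_jetOf (h𝒟 : IsOpen 𝒟) (hf : IsDiffFun 𝒟 f) (hU : IsOpen U)
    (hu : ∀ α, ContDiffOn ℝ ∞ (u α) U) (hu𝒟 : ∀ z ∈ U, jetOf u z ∈ 𝒟) (i : Fin 4) :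
    Set.EqOn (fun z => SurfaceFlux.totalD i f (jetOf u z))
      (partialD i fun z => f (jetOf u z)) U := by
  intro z hz
  obtain ⟨S, F, hSo, hF, hfF⟩ := hf.exists_rep h𝒟
  have hd : HasFDerivAt F (fderiv ℝ F (jetProj S (jetOf u z))) (jetProj S (jetOf u z)) :=
    ((hF.contDiffAt (hSo.mem_nhds ⟨_, hu𝒟 z hz, rfl⟩)).differentiableAt (by simp)).hasFDerivAt
  have hinner : HasFDerivAt (fun z => jetProj S (jetOf u z))
      ((ContinuousLinearMap.id ℝ Spacetime).prod
        (ContinuousLinearMap.pi fun c : S => fderiv ℝ (multiD c.1.2 (u c.1.1)) z)) z :=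
    (hasFDerivAt_id z).prodMk (hasFDerivAt_pi.2 fun c => (differentiableAt_of_contDiffOn hU
      (contDiffOn_multiD hU (hu _) _) hz).hasFDerivAt)
  have hcongr : Set.EqOn (fun z => f (jetOf u z)) (fun z => F (jetProj S (jetOf u z))) U :=
    fun y hy => hfF _ (hu𝒟 y hy)
  rw [eqOn_partialD hU hcongr i hz]
  have hchain : partialD i (fun z => F (jetProj S (jetOf u z))) z =
      fderiv ℝ F (jetProj S (jetOf u z)) (Pi.single i 1, fun c : S =>
        partialD i (multiD c.1.2 (u c.1.1)) z) :=
    congrArg (· (Pi.single i 1)) (hd.comp z hinner).fderiv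
  rw [hchain]
  change SurfaceFlux.totalD i f (jetOf u z) = _
  rw [totalD_eq_fderiv h𝒟 hF hfF i (hu𝒟 z hz)]
  congr 2
  -- The directions agree because differentiating a jet component raises its multi-index by `e_i`.
  funext c
  exact (partialD_multiD hU (hu _) i _ hz).symm

/-! ### Identities on the solution space -/

variable {P : PDESystem m M} {𝒪 : Set (Set Spacetime)}

/-- Equality on the solution space is equality along every solution. -/
theorem eqOnSol_iff : EqOnSol P 𝒪 f f' ↔ ∀ U ∈ 𝒪, ∀ u, P.IsSolutionOn U u →
    Set.EqOn (fun z => f (jetOf u z)) (fun z => f' (jetOf u z)) U := by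
  constructor
  · intro h U hU u hu z hz
    exact h _ ⟨U, hU, u, hu, z, hz, rfl⟩
  · rintro h _ ⟨U, hU, u, hu, z, hz, rfl⟩
    exact h U hU u hu hz

theorem IsDiffFun.contDiffOn_of_isSolutionOn (hf : IsDiffFun P.dom f) (hU : IsOpen U)
    (hu : P.IsSolutionOn U u) : ContDiffOn ℝ ∞ (fun z => f (jetOf u z)) U :=
  hf.contDiffOn_comp_jetOf hU hu.1 fun z hz => (hu.2 z hz).1

theorem IsDiffFun.totalD_of_isSolutionOn (hf : IsDiffFun P.dom f) (hU : IsOpen U)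
    (hu : P.IsSolutionOn U u) (i : Fin 4) :
    Set.EqOn (fun z => SurfaceFlux.totalD i f (jetOf u z))
      (partialD i fun z => f (jetOf u z)) U :=
  hf.partialD_comp_jetOf P.isOpen_dom hU hu.1 (fun z hz => (hu.2 z hz).1) i

/-- Total derivatives respect equality on the solution space. -/
theorem EqOnSol.totalD (h𝒪 : ∀ U ∈ 𝒪, IsOpen U) (hf : IsDiffFun P.dom f)
    (hf' : IsDiffFun P.dom f') (h : EqOnSol P 𝒪 f f') (i : Fin 4) :
    EqOnSol P 𝒪 (totalD i f) (totalD i f') := by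
  rw [eqOnSol_iff] at h ⊢
  intro U hU u hu z hz
  rw [hf.totalD_of_isSolutionOn (h𝒪 U hU) hu i hz, hf'.totalD_of_isSolutionOn (h𝒪 U hU) hu i hz]
  exact eqOn_partialD (h𝒪 U hU) (h U hU u hu) i hz

theorem eqOnSol_totalD_comm (h𝒪 : ∀ U ∈ 𝒪, IsOpen U) (hf : IsDiffFun P.dom f) (i j : Fin 4) :
    EqOnSol P 𝒪 (totalD i (totalD j f)) (totalD j (totalD i f)) := by
  rw [eqOnSol_iff]
  intro U hU u hu z hz
  have hUo := h𝒪 U hU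
  have key : ∀ a b : Fin 4, totalD a (totalD b f) (jetOf u z) =
      partialD a (partialD b fun z => f (jetOf u z)) z := fun a b =>
    ((hf.totalD P.isOpen_dom b).totalD_of_isSolutionOn hUo hu a hz).trans
      (eqOn_partialD hUo (hf.totalD_of_isSolutionOn hUo hu b) a hz)
  change totalD i (totalD j f) (jetOf u z) = totalD j (totalD i f) (jetOf u z)
  rw [key, key]
  exact partialD_comm hUo (hf.contDiffOn_of_isSolutionOn hUo hu) i j hz

theorem eqOnSol_totalD_add (h𝒪 : ∀ U ∈ 𝒪, IsOpen U) (hf : IsDiffFun P.dom f)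
    (hf' : IsDiffFun P.dom f') (i : Fin 4) :
    EqOnSol P 𝒪 (totalD i (f + f')) (totalD i f + totalD i f') := by
  rw [eqOnSol_iff]
  intro U hU u hu z hz
  have hUo := h𝒪 U hU
  rw [(hf.add hf').totalD_of_isSolutionOn hUo hu i hz]
  change _ = totalD i f (jetOf u z) + totalD i f' (jetOf u z)
  have e := hf.totalD_of_isSolutionOn hUo hu i hz
  have e' := hf'.totalD_of_isSolutionOn hUo hu i hz
  dsimp only at e e'
  rw [e, e']
  exact partialD_add hUo (hf.contDiffOn_of_isSolutionOn hUo hu)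
    (hf'.contDiffOn_of_isSolutionOn hUo hu) i hz

theorem IsDiffFun.neg (hf : IsDiffFun 𝒟 f) : IsDiffFun 𝒟 (-f) := by
  obtain ⟨S, F, hF, hfF⟩ := hf
  exact ⟨S, fun q => -F q, hF.neg, fun p hp => by rw [Pi.neg_apply, hfF p hp]⟩

theorem IsDiffFun.sub (hf : IsDiffFun 𝒟 f) (hf' : IsDiffFun 𝒟 f') : IsDiffFun 𝒟 (f - f') :=
  sub_eq_add_neg f f' ▸ hf.add hf'.neg

theorem eqOnSol_totalD_sub (h𝒪 : ∀ U ∈ 𝒪, IsOpen U) (hf : IsDiffFun P.dom f)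
    (hf' : IsDiffFun P.dom f') (i : Fin 4) :
    EqOnSol P 𝒪 (totalD i (f - f')) (totalD i f - totalD i f') := by
  intro p hp
  -- Additivity is applied to `(f - f') + f' = f`.
  have := eqOnSol_totalD_add h𝒪 (hf.sub hf') hf' i p hp
  rw [sub_add_cancel] at this
  simp only [Pi.add_apply, Pi.sub_apply] at this ⊢
  linarith

/-! ### Vector calculus identities on the solution space. -/

theorem IsVecDiffFun.curl {Θ : Fin 3 → Jet m → ℝ} (h𝒟 : IsOpen 𝒟) (hΘ : IsVecDiffFun 𝒟 Θ) :
    IsVecDiffFun 𝒟 (Curl Θ) := by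
  intro j
  fin_cases j
  all_goals exact ((hΘ _).totalD h𝒟 _).sub ((hΘ _).totalD h𝒟 _)

/-- `Div` respects equality on the solution space. -/
theorem VecEqOnSol.div (h𝒪 : ∀ U ∈ 𝒪, IsOpen U) {A B : Fin 3 → Jet m → ℝ}
    (hA : IsVecDiffFun P.dom A) (hB : IsVecDiffFun P.dom B) (h : VecEqOnSol P 𝒪 A B) :
    EqOnSol P 𝒪 (Div A) (Div B) := by
  intro p hp
  have e : ∀ i j, totalD i (A j) p = totalD i (B j) p := fun i j =>
    (h j).totalD h𝒪 (hA j) (hB j) i p hp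
  simp [Div, e]

theorem eqOnSol_div_curl (h𝒪 : ∀ U ∈ 𝒪, IsOpen U) {Θ : Fin 3 → Jet m → ℝ}
    (hΘ : IsVecDiffFun P.dom Θ) : EqOnSol P 𝒪 (Div (Curl Θ)) 0 := by
  intro p hp
  have hs : ∀ i a b j k, totalD i (totalD a (Θ j) - totalD b (Θ k)) p =
      totalD i (totalD a (Θ j)) p - totalD i (totalD b (Θ k)) p := fun i a b j k =>
    eqOnSol_totalD_sub h𝒪 ((hΘ j).totalD P.isOpen_dom a) ((hΘ k).totalD P.isOpen_dom b) i p hp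
  have hc : ∀ i a j, totalD i (totalD a (Θ j)) p = totalD a (totalD i (Θ j)) p := fun i a j =>
    eqOnSol_totalD_comm h𝒪 (hΘ j) i a p hp
  simp only [Div, Curl, Pi.add_apply, Pi.zero_apply, Matrix.cons_val_zero, Matrix.cons_val_one,
    Matrix.cons_val, hs]
  -- With the indices sorted increasingly, the six second-order terms cancel in pairs.
  rw [hc 2 1, hc 3 1, hc 3 2]
  ring

/-- If `T = Curl Θ` on the solution space, then `D_t T + Curl X` is there the curl of
`X + D_t Θ`. -/
theorem vecEqOnSol_curl_add_vecDt (h𝒪 : ∀ U ∈ 𝒪, IsOpen U) {T X Θ : Fin 3 → Jet m → ℝ}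
    (hT : IsVecDiffFun P.dom T) (hX : IsVecDiffFun P.dom X) (hΘ : IsVecDiffFun P.dom Θ)
    (h : VecEqOnSol P 𝒪 T (Curl Θ)) :
    VecEqOnSol P 𝒪 (Curl (X + vecDt Θ)) (vecDt T + Curl X) := by
  intro j p hp
  have ht : totalD 0 (T j) p = totalD 0 (Curl Θ j) p :=
    (h j).totalD h𝒪 (hT j) (hΘ.curl P.isOpen_dom j) 0 p hp
  have hs : ∀ a b j k, totalD 0 (totalD a (Θ j) - totalD b (Θ k)) p =
      totalD 0 (totalD a (Θ j)) p - totalD 0 (totalD b (Θ k)) p := fun a b j k =>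
    eqOnSol_totalD_sub h𝒪 ((hΘ j).totalD P.isOpen_dom a) ((hΘ k).totalD P.isOpen_dom b) 0 p hp
  have hc : ∀ a j, totalD a (totalD 0 (Θ j)) p = totalD 0 (totalD a (Θ j)) p := fun a j =>
    eqOnSol_totalD_comm h𝒪 (hΘ j) a 0 p hp
  have ha : ∀ i j, totalD i (X j + totalD 0 (Θ j)) p =
      totalD i (X j) p + totalD i (totalD 0 (Θ j)) p := fun i j =>
    eqOnSol_totalD_add h𝒪 (hX j) ((hΘ j).totalD P.isOpen_dom 0) i p hp
  change Curl (X + vecDt Θ) j p = totalD 0 (T j) p + Curl X j p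
  rw [ht]
  fin_cases j
  all_goals
    simp only [Curl, vecDt, Pi.add_apply, Pi.sub_apply, Matrix.cons_val_zero,
      Matrix.cons_val_one, Matrix.cons_val, Fin.zero_eta, Fin.mk_one, Fin.reduceFinMk, hs, ha, hc]
    ring

end SurfaceFlux

end

theorem mainTheorem9 {m M : ℕ} (P : SurfaceFlux.PDESystem m M)
    (𝒪 : Set (Set SurfaceFlux.Spacetime)) (h𝒪 : ∀ U ∈ 𝒪, IsOpen U)
    (T X : Fin 3 → SurfaceFlux.Jet m → ℝ) (hTX : SurfaceFlux.IsSurfaceFluxLaw P 𝒪 T X) :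
    (SurfaceFlux.IsLocallyTrivialSurfaceFlux P 𝒪 T X →
      SurfaceFlux.EqOnSol P 𝒪 (SurfaceFlux.Div T) 0) ∧
    ((¬ ∃ Ψ, SurfaceFlux.IsTopologicalFluxLaw P 𝒪 Ψ ∧
        ¬ SurfaceFlux.IsTrivialTopologicalFlux P 𝒪 Ψ) →
      (¬ ∃ Ψ, SurfaceFlux.IsTopologicalCirculationLaw P 𝒪 Ψ ∧
        ¬ SurfaceFlux.IsTrivialTopologicalCirculation P 𝒪 Ψ) →
      SurfaceFlux.EqOnSol P 𝒪 (SurfaceFlux.Div T) 0 →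
      SurfaceFlux.IsLocallyTrivialSurfaceFlux P 𝒪 T X) := by
  refine ⟨?_, ?_⟩
  · rintro ⟨Θ, Λ, hΘ, -, hT, -⟩ p hp
    exact (hT.div h𝒪 hTX.density (hΘ.curl P.isOpen_dom) p hp).trans
      (SurfaceFlux.eqOnSol_div_curl h𝒪 hΘ p hp)
  · intro hflux hcirc hdiv
    push Not at hflux hcirc
    -- The density itself is a topological flux law.
    obtain ⟨Θ, hΘ, hT⟩ := hflux T ⟨hTX.density, hdiv⟩
    -- `X + D_t Θ` is curl-free on solutions by the conservation law, and its potential is `Λ`.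
    obtain ⟨Λ, hΛ, hX⟩ := hcirc (X + SurfaceFlux.vecDt Θ)
      ⟨fun j => (hTX.flux j).add ((hΘ j).totalD P.isOpen_dom 0), fun j p hp =>
        (SurfaceFlux.vecEqOnSol_curl_add_vecDt h𝒪 hTX.density hTX.flux hΘ hT j p hp).trans
          (hTX.conserved j p hp)⟩
    refine ⟨Θ, Λ, hΘ, hΛ, hT, fun j p hp => ?_⟩
    have := hX j p hp
    simp only [Pi.add_apply, Pi.neg_apply] at this ⊢
    linarith
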